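/- Let $n\in\mathbb{N}$, let $A,B$ be positive definite complex $n\times n$ matrices, let $X$ be any complex $n\times n$ matrix, and let $|||\cdot|||$ be any unitarily invariant norm on the complex $n\times n$ matrices, that is, a norm with $|||UYV|||=|||Y|||$ for every matrix $Y$ and all unitary matrices $U,V$. Then the function $$f(\nu)=|||A^{\nu}XB^{1-\nu}+A^{1-\nu}XB^{\nu}|||$$ is convex on $\mathbb{R}$, where the real powers of a positive definite matrix are those given by the functional calculus. -/

import Mathlib

open scoped Matrix ComplexOrder MatrixOrder

/-- A unitarily invariant norm on the complex `n × n` matrices: a seminorm `N` that is definite,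
hence a norm, with `N (U * X * V) = N X` for all matrices `X` and all unitary `U`, `V`. -/
structure IsUnitarilyInvariantNorm {n : ℕ}
    (N : Seminorm ℂ (Matrix (Fin n) (Fin n) ℂ)) : Prop where
  eq_zero_of_map_eq_zero : ∀ X : Matrix (Fin n) (Fin n) ℂ, N X = 0 → X = 0
  map_unitary_mul_mul_unitary : ∀ (X : Matrix (Fin n) (Fin n) ℂ),
    ∀ U ∈ Matrix.unitaryGroup (Fin n) ℂ, ∀ V ∈ Matrix.unitaryGroup (Fin n) ℂ,
      N (U * X * V) = N X

/-!
For positive definite `A` and `B`, write `H ν = A ^ ν * X * B ^ (1 - ν) + A ^ (1 - ν) * X * B ^ ν`.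
In orthonormal eigenbases of `A` and `B`, with eigenvalues `exp (a i)` and `exp (b j)`, the average
of `H (ν + t)` and `H (ν - t)` arises from `H ν` by multiplying its `(i, j)` entry by
`cosh (t * (a i - b j))`. Since `ν ↦ N (H ν)` is continuous, convexity follows from midpoint
convexity (`convexOn_univ_of_continuous_of_le_midpoint`), and hence from the claim that these
entrywise multiplications do not decrease a unitarily invariant norm
(`IsUnitarilyInvariantNorm.le_map_cosh`).

To prove the claim, let `Φ φ` be the entrywise multiplication by `φ (a i - b j)`. The operators
`Φ (exp (I * k * x))`, for real `k`, are multiplications by unitary diagonal matrices on the two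
sides, so they form a one-parameter group of isometries. Its generator being dissipative,
`Φ (x - r)` expands the norm by at least the factor `‖r‖` when `r` is purely imaginary
(`IsUnitarilyInvariantNorm.norm_mul_le_map_sub`). Consequently `Φ p` expands the norm by at least
`‖p 0‖` for every polynomial `p` with purely imaginary roots
(`IsUnitarilyInvariantNorm.norm_eval_zero_mul_le`). The polynomials
`((1 + x / m) ^ m + (1 - x / m) ^ m) / 2` have purely imaginary roots and the value `1` at `0`,
and they converge to `cosh x`.
-/

open Filter Topology Polynomial

/-! ### Continuous midpoint convex functions -/

/-- A continuous function on `ℝ` lying below its symmetric averages is convex: otherwise the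
difference between the function and a chord has a positive maximum, and the leftmost point where
it is attained violates the midpoint inequality. -/
theorem convexOn_univ_of_continuous_of_le_midpoint {f : ℝ → ℝ} (hf : Continuous f)
    (hmid : ∀ x t, f x ≤ (f (x + t) + f (x - t)) / 2) : ConvexOn ℝ Set.univ f := by
  refine ⟨convex_univ, fun x _ y _ α β hα hβ hαβ => ?_⟩
  set g : ℝ → ℝ := fun s => f (x + s * (y - x)) - (f x + s * (f y - f x)) with hg
  have hgc : Continuous g := by fun_prop
  have hgmid : ∀ s t, g s ≤ (g (s + t) + g (s - t)) / 2 := fun s t => by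
    have := hmid (x + s * (y - x)) (t * (y - x))
    rw [show x + s * (y - x) + t * (y - x) = x + (s + t) * (y - x) by ring,
      show x + s * (y - x) - t * (y - x) = x + (s - t) * (y - x) by ring] at this
    simp only [hg]
    linarith
  suffices h : g β ≤ 0 by
    obtain rfl : α = 1 - β := by linarith
    simp only [hg] at h
    simp only [smul_eq_mul]
    rw [show (1 - β) * x + β * y = x + β * (y - x) by ring]
    linarith
  by_contra! hpos
  have hβI : β ∈ Set.Icc (0 : ℝ) 1 := ⟨hβ, by linarith⟩
  obtain ⟨c₀, hc₀, hmax⟩ := isCompact_Icc.exists_isMaxOn ⟨β, hβI⟩ hgc.continuousOn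
  have hK : IsCompact (Set.Icc (0 : ℝ) 1 ∩ g ⁻¹' {g c₀}) :=
    isCompact_Icc.inter_right (isClosed_singleton.preimage hgc)
  obtain ⟨c, ⟨hcI, hc⟩, hleast⟩ := hK.exists_isLeast ⟨c₀, hc₀, rfl⟩
  have hc : g c = g c₀ := hc
  have hle : ∀ s ∈ Set.Icc (0 : ℝ) 1, g s ≤ g c := fun s hs => hc ▸ hmax hs
  have hcpos : 0 < g c := hpos.trans_le (hle β hβI)
  have hc0 : c ≠ 0 := by rintro rfl; simp [hg] at hcpos
  have hc1 : c ≠ 1 := by rintro rfl; simp [hg] at hcpos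
  have h0 : 0 < c := lt_of_le_of_ne hcI.1 hc0.symm
  have h1 : c < 1 := lt_of_le_of_ne hcI.2 hc1
  obtain ⟨t, ht, htc, ht1⟩ : ∃ t, 0 < t ∧ t ≤ c ∧ t ≤ 1 - c :=
    ⟨min c (1 - c), lt_min h0 (by linarith), min_le_left .., min_le_right ..⟩
  have hl : c - t ∈ Set.Icc (0 : ℝ) 1 := ⟨by linarith, by linarith⟩
  have hr : c + t ∈ Set.Icc (0 : ℝ) 1 := ⟨by linarith, by linarith⟩
  have hlt : g (c - t) < g c := lt_of_le_of_ne (hle _ hl) fun h => by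
    have := hleast ⟨hl, h.trans hc⟩
    linarith
  linarith [hgmid c t, hle _ hr]

/-! ### Seminorms on matrices -/

/-- Every seminorm on complex matrices is continuous for the topology of entrywise convergence. -/
theorem Matrix.continuous_seminorm {n : ℕ} (N : Seminorm ℂ (Matrix (Fin n) (Fin n) ℂ)) :
    Continuous N := by
  refine Seminorm.continuous_of_continuousAt_zero ?_
  have hbound : ∀ M : Matrix (Fin n) (Fin n) ℂ,
      N M ≤ ∑ i, ∑ j, ‖M i j‖ * N (Matrix.single i j 1) := fun M => by
    conv_lhs => rw [Matrix.matrix_eq_sum_single M]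
    refine (Finset.le_sum_of_subadditive N (map_zero N).le (map_add_le_add N) _ _).trans
      (Finset.sum_le_sum fun i _ => ?_)
    refine (Finset.le_sum_of_subadditive N (map_zero N).le (map_add_le_add N) _ _).trans
      (Finset.sum_le_sum fun j _ => ?_)
    rw [← map_smul_eq_mul, Matrix.smul_single, smul_eq_mul, mul_one]
  have hcont : Continuous fun M : Matrix (Fin n) (Fin n) ℂ =>
      ∑ i, ∑ j, ‖M i j‖ * N (Matrix.single i j 1) := by fun_prop
  have hlim := hcont.tendsto 0
  simp only [Matrix.zero_apply, norm_zero, zero_mul, Finset.sum_const_zero] at hlim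
  simpa [ContinuousAt] using squeeze_zero (fun M => apply_nonneg N M) hbound hlim

/-! ### Entrywise multiplication by a function of a difference -/

/-- The matrix with entries `φ (a i - b j) * Y i j`. If `φ` is a power of `x ↦ x`, this is the
corresponding power of the commutator-like map `Y ↦ diagonal a * Y - Y * diagonal b`. -/
def differenceMultiplier {n : ℕ} (a b : Fin n → ℝ) (φ : ℝ → ℂ) (Y : Matrix (Fin n) (Fin n) ℂ) :
    Matrix (Fin n) (Fin n) ℂ :=
  Matrix.of fun i j => φ (a i - b j) * Y i j

theorem tendsto_differenceMultiplier {n : ℕ} {ι : Type*} {l : Filter ι} (a b : Fin n → ℝ)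
    {φ : ι → ℝ → ℂ} {ψ : ℝ → ℂ} (h : ∀ x, Tendsto (φ · x) l (𝓝 (ψ x)))
    (Y : Matrix (Fin n) (Fin n) ℂ) :
    Tendsto (fun k => differenceMultiplier a b (φ k) Y) l (𝓝 (differenceMultiplier a b ψ Y)) :=
  tendsto_pi_nhds.2 fun i => tendsto_pi_nhds.2 fun j => (h (a i - b j)).mul_const (Y i j)

theorem Matrix.diagonal_exp_mul_I_mem_unitaryGroup {n : ℕ} (a : Fin n → ℝ) :
    Matrix.diagonal (fun i => Complex.exp (a i * Complex.I)) ∈ Matrix.unitaryGroup (Fin n) ℂ := by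
  rw [Matrix.mem_unitaryGroup_iff, Matrix.star_eq_conjTranspose, Matrix.diagonal_conjTranspose,
    Matrix.diagonal_mul_diagonal, ← Matrix.diagonal_one]
  congr 1
  funext i
  simp [← Complex.exp_conj, ← Complex.exp_add]

/-- The polynomial `(m + X) ^ m + (m - X) ^ m` has purely imaginary roots: at a root `r` the numbers
`m + r` and `m - r` have the same modulus, so `r` is as far from `-m` as from `m`. -/
theorem Complex.re_eq_zero_of_add_pow_add_sub_pow_eq_zero {m : ℕ} (hm : m ≠ 0) {r : ℂ}
    (h : (m + r) ^ m + (m - r) ^ m = 0) : r.re = 0 := by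
  have hpow : ‖(m : ℂ) + r‖ ^ m = ‖(m : ℂ) - r‖ ^ m := by
    rw [← norm_pow, ← norm_pow, eq_neg_of_add_eq_zero_left h, norm_neg]
  have hnorm : ‖(m : ℂ) + r‖ = ‖(m : ℂ) - r‖ :=
    (pow_left_inj₀ (norm_nonneg _) (norm_nonneg _) hm).1 hpow
  have hsq : Complex.normSq (m + r) = Complex.normSq (m - r) := by
    rw [Complex.normSq_eq_norm_sq, Complex.normSq_eq_norm_sq, hnorm]
  simp only [Complex.normSq_apply, Complex.add_re, Complex.add_im, Complex.sub_re, Complex.sub_im,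
    Complex.natCast_re, Complex.natCast_im] at hsq
  have hm' : (m : ℝ) ≠ 0 := by exact_mod_cast hm
  have : (m : ℝ) * r.re = 0 := by linarith
  exact (mul_eq_zero.1 this).resolve_left hm'

/-! ### Entrywise multiplications that expand a unitarily invariant norm -/

namespace IsUnitarilyInvariantNorm

variable {n : ℕ} {N : Seminorm ℂ (Matrix (Fin n) (Fin n) ℂ)}

/-- This multiplication is `Y ↦ U * Y * V` with the unitary diagonal matrices `U = exp (I * k * a)`
and `V = exp (-I * k * b)`. -/
theorem map_exp_mul_I (hN : IsUnitarilyInvariantNorm N) (a b : Fin n → ℝ) (k : ℝ)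
    (Y : Matrix (Fin n) (Fin n) ℂ) :
    N (differenceMultiplier a b (fun x => Complex.exp ((k * x : ℝ) * Complex.I)) Y) = N Y := by
  rw [← hN.map_unitary_mul_mul_unitary Y _
    (Matrix.diagonal_exp_mul_I_mem_unitaryGroup fun i => k * a i) _
    (Matrix.diagonal_exp_mul_I_mem_unitaryGroup fun j => -(k * b j))]
  congr 1
  ext i j
  rw [Matrix.mul_diagonal, Matrix.diagonal_mul, mul_right_comm, ← Complex.exp_add]
  simp only [differenceMultiplier, Matrix.of_apply]
  congr 2
  push_cast
  ring

/-- Dissipativity of the generator of a group of isometries: multiplication by `x - y * I`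
expands the norm by at least the factor `|y|`. -/
theorem abs_mul_le_map_sub_mul_I (hN : IsUnitarilyInvariantNorm N) (a b : Fin n → ℝ) (y : ℝ)
    (Y : Matrix (Fin n) (Fin n) ℂ) :
    |y| * N Y ≤ N (differenceMultiplier a b (fun x => x - y * Complex.I) Y) := by
  rcases eq_or_ne y 0 with rfl | hy
  · simp
  -- The difference quotient of the group at `0`, in the direction that makes `-y * I * x` its
  -- limit, shifted by `-y ^ 2`: its limit is `-y * I * (x - y * I)`.
  set φ : ℝ → ℝ → ℂ := fun k x =>
    (k : ℂ)⁻¹ * (Complex.exp ((-y * k * x : ℝ) * Complex.I) - 1) - y ^ 2 with hφ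
  have hlim : ∀ x, Tendsto (φ · x) (𝓝[>] 0) (𝓝 (-y * Complex.I * (x - y * Complex.I))) := by
    intro x
    have hd : HasDerivAt (fun k : ℝ => Complex.exp ((-y * k * x : ℝ) * Complex.I))
        (-y * x * Complex.I) 0 := by
      have h1 : HasDerivAt (fun k : ℝ => ((-y * k * x : ℝ) : ℂ) * Complex.I)
          (-y * x * Complex.I) 0 := by
        have h2 : HasDerivAt (fun k : ℝ => -y * k * x) (-y * x) 0 := by
          simpa using ((hasDerivAt_id (0 : ℝ)).const_mul (-y)).mul_const x
        simpa using h2.ofReal_comp.mul_const Complex.I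
      simpa using h1.cexp
    have hs := hd.tendsto_slope_zero.mono_left
      (nhdsWithin_mono (0 : ℝ) (show Set.Ioi (0 : ℝ) ⊆ {0}ᶜ from fun k hk => ne_of_gt hk))
    rw [show -y * Complex.I * (x - y * Complex.I) = -y * x * Complex.I - (y : ℂ) ^ 2 by
      linear_combination (y : ℂ) ^ 2 * Complex.I_sq]
    simpa [hφ] using hs.sub_const ((y : ℂ) ^ 2)
  have hle : ∀ k : ℝ, 0 < k → y ^ 2 * N Y ≤ N (differenceMultiplier a b (φ k) Y) := by
    intro k hk
    have hsplit : ((1 + k * y ^ 2 : ℝ) : ℂ) • Y =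
        differenceMultiplier a b (fun x => Complex.exp ((-y * k * x : ℝ) * Complex.I)) Y
          - (k : ℂ) • differenceMultiplier a b (φ k) Y := by
      have hk' : (k : ℂ) ≠ 0 := by exact_mod_cast hk.ne'
      ext i j
      simp only [differenceMultiplier, hφ, Matrix.smul_apply, Matrix.sub_apply, Matrix.of_apply,
        smul_eq_mul]
      field_simp
      push_cast
      ring
    have h := map_sub_le_add N
      (differenceMultiplier a b (fun x => Complex.exp ((-y * k * x : ℝ) * Complex.I)) Y)
      ((k : ℂ) • differenceMultiplier a b (φ k) Y)
    rw [← hsplit, hN.map_exp_mul_I, map_smul_eq_mul, map_smul_eq_mul, Complex.norm_real,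
      Complex.norm_real, Real.norm_of_nonneg (by positivity), Real.norm_of_nonneg hk.le] at h
    refine le_of_mul_le_mul_left ?_ hk
    linarith
  have hmul : N (differenceMultiplier a b (fun x => -y * Complex.I * (x - y * Complex.I)) Y) =
      |y| * N (differenceMultiplier a b (fun x => x - y * Complex.I) Y) := by
    have : differenceMultiplier a b (fun x => -y * Complex.I * (x - y * Complex.I)) Y =
        (-y * Complex.I) • differenceMultiplier a b (fun x => x - y * Complex.I) Y := by
      ext i j
      simp [differenceMultiplier, mul_assoc]
    rw [this, map_smul_eq_mul]
    simp
  have hge := ge_of_tendsto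
    (((Matrix.continuous_seminorm N).tendsto _).comp (tendsto_differenceMultiplier a b hlim Y))
    (eventually_mem_nhdsWithin.mono fun k hk => hle k hk)
  rw [hmul, ← sq_abs, sq, mul_assoc] at hge
  exact le_of_mul_le_mul_left hge (abs_pos.2 hy)

theorem norm_mul_le_map_sub (hN : IsUnitarilyInvariantNorm N) (a b : Fin n → ℝ) {r : ℂ}
    (hr : r.re = 0) (Y : Matrix (Fin n) (Fin n) ℂ) :
    ‖r‖ * N Y ≤ N (differenceMultiplier a b (fun x => x - r) Y) := by
  obtain ⟨y, rfl⟩ : ∃ y : ℝ, r = y * Complex.I := ⟨r.im, Complex.ext (by simp [hr]) (by simp)⟩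
  simpa using hN.abs_mul_le_map_sub_mul_I a b y Y

theorem norm_eval_zero_mul_le (hN : IsUnitarilyInvariantNorm N) (a b : Fin n → ℝ) {p : ℂ[X]}
    (hp : ∀ r ∈ p.roots, r.re = 0) (Y : Matrix (Fin n) (Fin n) ℂ) :
    ‖p.eval 0‖ * N Y ≤ N (differenceMultiplier a b (fun x => p.eval (x : ℂ)) Y) := by
  have key : ∀ s : Multiset ℂ, (∀ r ∈ s, r.re = 0) → ∀ c : ℂ,
      ‖(C c * (s.map fun r => X - C r).prod).eval 0‖ * N Y ≤
        N (differenceMultiplier a b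
          (fun x => (C c * (s.map fun r => X - C r).prod).eval (x : ℂ)) Y) := by
    intro s hs c
    induction s using Multiset.induction_on with
    | empty =>
      have : differenceMultiplier a b (fun _ => c) Y = c • Y := by
        ext i j
        simp [differenceMultiplier]
      simp [this, map_smul_eq_mul]
    | cons r s ih =>
      have hsplit : differenceMultiplier a b
          (fun x => (C c * ((r ::ₘ s).map fun r => X - C r).prod).eval (x : ℂ)) Y =
          differenceMultiplier a b (fun x => x - r) (differenceMultiplier a b
            (fun x => (C c * (s.map fun r => X - C r).prod).eval (x : ℂ)) Y) := by
        ext i j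
        simp only [differenceMultiplier, Matrix.of_apply, Multiset.map_cons, Multiset.prod_cons,
          eval_mul, eval_sub, eval_X, eval_C]
        ring
      rw [hsplit]
      refine le_trans ?_ (hN.norm_mul_le_map_sub a b (hs r (Multiset.mem_cons_self ..)) _)
      refine le_trans (le_of_eq ?_) (mul_le_mul_of_nonneg_left
        (ih fun q hq => hs q (Multiset.mem_cons_of_mem hq)) (norm_nonneg r))
      simp only [Multiset.map_cons, Multiset.prod_cons, eval_mul, eval_sub, eval_X, eval_C,
        norm_mul, zero_sub, norm_neg]
      ring
  have h := key p.roots hp p.leadingCoeff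
  rwa [← (IsAlgClosed.splits p).eq_prod_roots] at h

theorem le_map_cosh (hN : IsUnitarilyInvariantNorm N) (a b : Fin n → ℝ)
    (Y : Matrix (Fin n) (Fin n) ℂ) :
    N Y ≤ N (differenceMultiplier a b (fun x => Complex.cosh x) Y) := by
  set φ : ℕ → ℝ → ℂ := fun m x => ((1 + (x : ℂ) / m) ^ m + (1 + (-x : ℂ) / m) ^ m) / 2 with hφ
  have hlim : ∀ x, Tendsto (φ · x) atTop (𝓝 (Complex.cosh x)) := fun x =>
    ((Complex.tendsto_one_add_div_pow_exp x).add
      (Complex.tendsto_one_add_div_pow_exp (-x))).div_const 2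
  have hle : ∀ m : ℕ, m ≠ 0 → N Y ≤ N (differenceMultiplier a b (φ m) Y) := by
    intro m hm
    have hm' : (m : ℂ) ≠ 0 := by exact_mod_cast hm
    set p : ℂ[X] := (C (m : ℂ) + X) ^ m + (C (m : ℂ) - X) ^ m with hp
    have heval : ∀ z, p.eval z = (m + z) ^ m + (m - z) ^ m := fun z => by simp [hp]
    have hroots : ∀ r ∈ p.roots, r.re = 0 := fun r hr =>
      Complex.re_eq_zero_of_add_pow_add_sub_pow_eq_zero hm
        ((heval r).symm.trans (isRoot_of_mem_roots hr))
    have h := hN.norm_eval_zero_mul_le a b hroots Y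
    have hsmul : differenceMultiplier a b (fun x => p.eval (x : ℂ)) Y =
        (p.eval 0) • differenceMultiplier a b (φ m) Y := by
      ext i j
      simp only [differenceMultiplier, Matrix.smul_apply, Matrix.of_apply, smul_eq_mul, hφ, heval]
      generalize (((a i - b j : ℝ)) : ℂ) = x
      have h1 : (m : ℂ) + x = m * (1 + x / m) := by field_simp
      have h2 : (m : ℂ) - x = m * (1 + -x / m) := by field_simp; ring
      rw [h1, h2, mul_pow, mul_pow, add_zero, sub_zero]
      ring
    have h0 : 0 < ‖p.eval 0‖ := by
      rw [norm_pos_iff, heval, add_zero, sub_zero, ← two_mul]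
      exact mul_ne_zero two_ne_zero (pow_ne_zero _ hm')
    rw [hsmul, map_smul_eq_mul] at h
    exact le_of_mul_le_mul_left h h0
  exact ge_of_tendsto
    (((Matrix.continuous_seminorm N).tendsto _).comp (tendsto_differenceMultiplier a b hlim Y))
    ((eventually_ne_atTop 0).mono hle)

end IsUnitarilyInvariantNorm

/-! ### Powers of positive definite matrices in an eigenbasis -/

/-- All real powers of a positive definite matrix are diagonal in one common orthonormal basis;
`a` lists the logarithms of the eigenvalues. -/
theorem Matrix.PosDef.exists_rpow_eq {n : ℕ} {A : Matrix (Fin n) (Fin n) ℂ} (hA : A.PosDef) :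
    ∃ U ∈ Matrix.unitaryGroup (Fin n) ℂ, ∃ a : Fin n → ℝ, ∀ ν : ℝ,
      A ^ ν = U * Matrix.diagonal (fun i => Complex.exp (ν * a i)) * star U := by
  refine ⟨hA.1.eigenvectorUnitary, SetLike.coe_mem _, fun i => Real.log (hA.1.eigenvalues i),
    fun ν => ?_⟩
  rw [CFC.rpow_eq_cfc_real hA.posSemidef.nonneg, hA.1.cfc_eq, Matrix.IsHermitian.cfc,
    Unitary.conjStarAlgAut_apply]
  congr 3
  funext i
  simp only [Function.comp_apply, Real.rpow_def_of_pos (hA.eigenvalues_pos i)]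
  norm_cast
  simp [mul_comm]

theorem mainTheorem4 {n : ℕ} (A B X : Matrix (Fin n) (Fin n) ℂ) (hA : A.PosDef) (hB : B.PosDef)
    (N : Seminorm ℂ (Matrix (Fin n) (Fin n) ℂ)) (hN : IsUnitarilyInvariantNorm N) :
    ConvexOn ℝ Set.univ
      (fun ν : ℝ => N (A ^ ν * X * B ^ (1 - ν) + A ^ (1 - ν) * X * B ^ ν)) := by
  obtain ⟨U, hU, a, ha⟩ := hA.exists_rpow_eq
  obtain ⟨V, hV, b, hb⟩ := hB.exists_rpow_eq
  -- `Y` is `X` in the eigenbases, and `D ν` is the matrix of the statement in them.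
  set Y := star U * X * V
  set D : ℝ → Matrix (Fin n) (Fin n) ℂ := fun ν => Matrix.of fun i j =>
    (Complex.exp (ν * a i + (1 - ν) * b j) + Complex.exp ((1 - ν) * a i + ν * b j)) * Y i j with hD
  have hterm : ∀ μ ν : ℝ, A ^ μ * X * B ^ ν =
      U * (Matrix.diagonal (fun i => Complex.exp (μ * a i)) * Y *
        Matrix.diagonal fun j => Complex.exp (ν * b j)) * star V := fun μ ν => by
    rw [ha, hb]
    simp only [Y, Matrix.mul_assoc]
  have hnorm : ∀ ν : ℝ, N (A ^ ν * X * B ^ (1 - ν) + A ^ (1 - ν) * X * B ^ ν) = N (D ν) := by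
    intro ν
    rw [hterm, hterm, ← Matrix.add_mul, ← Matrix.mul_add,
      hN.map_unitary_mul_mul_unitary _ U hU _ (Unitary.star_mem hV)]
    congr 1
    ext i j
    simp only [hD, Matrix.add_apply, Matrix.mul_diagonal, Matrix.diagonal_mul, Matrix.of_apply,
      Complex.exp_add]
    push_cast
    ring
  simp only [hnorm]
  have hDc : Continuous D :=
    continuous_pi fun i => continuous_pi fun j => by simp only [hD, Matrix.of_apply]; fun_prop
  refine convexOn_univ_of_continuous_of_le_midpoint
    ((Matrix.continuous_seminorm N).comp hDc) fun ν t => ?_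
  -- Scaling `a` and `b` by `t` makes this the multiplication by `cosh (t * (a i - b j))`.
  have hcosh : differenceMultiplier (fun i => t * a i) (fun j => t * b j)
      (fun x => Complex.cosh x) (D ν) = (2⁻¹ : ℂ) • (D (ν + t) + D (ν - t)) := by
    ext i j
    simp only [differenceMultiplier, hD, Matrix.smul_apply, Matrix.add_apply, Matrix.of_apply,
      smul_eq_mul, Complex.cosh]
    rw [← add_mul, ← mul_assoc, ← mul_assoc]
    congr 1
    rw [div_mul_eq_mul_div, div_eq_inv_mul]
    congr 1
    simp only [add_mul, mul_add, ← Complex.exp_add]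
    push_cast
    ring_nf
  have h := hN.le_map_cosh (fun i => t * a i) (fun j => t * b j) (D ν)
  rw [hcosh, map_smul_eq_mul] at h
  have h' := map_add_le_add N (D (ν + t)) (D (ν - t))
  norm_num at h
  linarith
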